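/- Let $M$ be a positive Borel measure on $\mathbb R$ such that all polynomials $\mathbb C[x]$ belong to $L^2(M)$, and let $q_n=\int_{\mathbb R}x^n\,dM(x)$, $n=0,1,2,\dots$, be its moments. Let $\mathcal D\subset\ell^2=\ell^2(\mathbb Z_{\ge 0})$ be the dense subspace of complex sequences with only finitely many non-zero terms, and let $A$ be the densely defined operator from $\ell^2$ to $L^2(M)$ with domain $\mathcal D$ given by $$Ag(x)=\sum_{n\ge 0}g_nx^n,\qquad g=(g_0,g_1,\dots)\in\mathcal D.$$ Suppose that $\sqrt[2n]{q_{2n}}=o(n)$ as $n\to\infty$. Then the moment problem is determinate, i.e. $M$ is the only positive Borel measure on $\mathbb R$ with $\mathbb C[x]$ contained in its $L^2$-space and with moments $(q_n)_{n\ge 0}$. Moreover, if $A$ is closable, then $M(\mathbb R\setminus(-1,1))=0$; in other words, $\operatorname{supp}M\subseteq[-1,1]$ and $M(\{1\})=M(\{-1\})=0$. -/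

import Mathlib

open MeasureTheory Filter
open scoped ENNReal lp Asymptotics

noncomputable section

namespace HamburgerMoment

/-- `ℂ[x]` is contained in `L²(M)`. -/
def PolynomialsInL2 (M : Measure ℝ) : Prop :=
  ∀ p : Polynomial ℂ, MemLp (fun x : ℝ => p.eval (x : ℂ)) 2 M

/-- The `n`-th moment of `M`. -/
def moment (M : Measure ℝ) (n : ℕ) : ℝ := ∫ x : ℝ, x ^ n ∂M

/-- `M` solves the Hamburger moment problem with data `q`. -/
def IsSolution (q : ℕ → ℝ) (M : Measure ℝ) : Prop :=
  PolynomialsInL2 M ∧ ∀ n : ℕ, moment M n = q n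

/-- The moment problem with data `q` is determinate: it has exactly one solution. -/
def Determinate (q : ℕ → ℝ) : Prop := ∃! M : Measure ℝ, IsSolution q M

/-- The subspace `𝒟` of `ℓ²` of sequences with only finitely many non-zero terms. -/
def finiteSequences : Submodule ℂ ℓ²(ℕ, ℂ) where
  carrier := {g | (Function.support (g : ℕ → ℂ)).Finite}
  add_mem' := by
    intro a b ha hb
    refine (Set.Finite.union ha hb).subset ?_
    rw [lp.coeFn_add]
    exact Function.support_add _ _
  zero_mem' := by
    refine Set.Finite.subset Set.finite_empty ?_
    intro n hn
    exact hn rfl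
  smul_mem' := by
    intro c a ha
    refine Set.Finite.subset ha ?_
    rw [lp.coeFn_smul]
    exact Function.support_const_smul_subset c _

theorem finite_support_monomial (g : finiteSequences) :
    (Function.support fun n : ℕ => Polynomial.monomial n ((g : ℓ²(ℕ, ℂ)) n)).Finite := by
  refine Set.Finite.subset g.2 ?_
  intro n hn h0
  exact hn (by simp [h0])

/-- The polynomial `∑ gₙ xⁿ` attached to `g ∈ 𝒟`. -/
def toPolynomial : finiteSequences →ₗ[ℂ] Polynomial ℂ where
  toFun g := ∑ᶠ n : ℕ, Polynomial.monomial n ((g : ℓ²(ℕ, ℂ)) n)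
  map_add' a b := by
    rw [← finsum_add_distrib (finite_support_monomial a) (finite_support_monomial b)]
    simp
  map_smul' c a := by
    rw [RingHom.id_apply, smul_finsum' c (finite_support_monomial a)]
    simp [Polynomial.smul_monomial]

/-- A polynomial, restricted to the real line, as an element of `L²(M)`. -/
def polynomialToL2 (M : Measure ℝ) (hM : PolynomialsInL2 M) :
    Polynomial ℂ →ₗ[ℂ] Lp ℂ 2 M where
  toFun p := (hM p).toLp (fun x : ℝ => p.eval (x : ℂ))
  map_add' p r := by
    rw [← MemLp.toLp_add]
    exact MemLp.toLp_congr _ _ (Eventually.of_forall fun x => by simp)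
  map_smul' c p := by
    rw [RingHom.id_apply, ← MemLp.toLp_const_smul]
    exact MemLp.toLp_congr _ _ (Eventually.of_forall fun x => by simp)

/-- The operator `A` with domain `𝒟`, from `ℓ²` to `L²(M)`, `Ag(x) = ∑ gₙ xⁿ`. -/
def operatorA (M : Measure ℝ) (hM : PolynomialsInL2 M) : ℓ²(ℕ, ℂ) →ₗ.[ℂ] Lp ℂ 2 M where
  domain := finiteSequences
  toFun := (polynomialToL2 M hM).comp toPolynomial

end HamburgerMoment

end

noncomputable section

namespace HamburgerMoment

/-! Determinacy: the growth condition makes `exp (t * |x|)` integrable for every `t`, so the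
characteristic function is the sum of its moment series (`hasSum_integral_exp`) and the moments fix
the measure.

Support: if `A` is closable, only `0` is orthogonal to the domain of its adjoint
(`eq_zero_of_isClosable`). For `k` in that domain the density `u = conj k` has moments in ℓ², hence
bounded and tending to zero. Boundedness makes the expansion of the Cauchy transform of `u dM` at
infinity converge for `1 < ‖w‖`. It agrees with the transform off the real axis where `1 < |w.re|`
(`cauchyTransform_eq_momentSeries`), so the transform has no jump across the real line beyond `±1`,
and contour integration gives `u = 0` a.e. there. Decay of the moments removes atoms of `u dM` at
`±1`. Every such `k` thus vanishes a.e. off `(-1, 1)`, so the indicator of the complement is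
orthogonal to the adjoint domain and is zero in L². -/

/-! ### Moment growth and exponential integrability -/

theorem summable_of_isLittleO {a : ℕ → ℝ} (ha : ∀ n, 0 ≤ a n)
    (h : (fun n : ℕ => a n ^ (1 / (2 * (n : ℝ)))) =o[atTop] (fun n : ℕ => (n : ℝ))) (t : ℝ) :
    Summable fun n : ℕ => t ^ (2 * n) / (2 * n).factorial * a n := by
  -- Since `m ^ m / m! ≤ e ^ m` with `m = 2n`, and `ε * n = (ε / 2) * m`, this choice bounds the
  -- late terms by `(1 / 4) ^ n`.
  obtain ⟨ε, hε, hε'⟩ : ∃ ε : ℝ, 0 < ε ∧ |t| * ε * Real.exp 1 ≤ 1 := by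
    refine ⟨(|t| * Real.exp 1 + 1)⁻¹, by positivity, ?_⟩
    have h1 : 0 < |t| * Real.exp 1 + 1 := by positivity
    rw [mul_right_comm, ← div_eq_mul_inv, div_le_one h1]
    linarith
  have hb : ∀ᶠ n : ℕ in atTop, a n ≤ (ε * n) ^ (2 * n) := by
    filter_upwards [h.def hε, eventually_gt_atTop 0] with n hn hn0
    have hn1 : (0 : ℝ) < n := by exact_mod_cast hn0
    rw [Real.norm_of_nonneg (Real.rpow_nonneg (ha n) _), Real.norm_of_nonneg hn1.le] at hn
    have h2 := pow_le_pow_left₀ (Real.rpow_nonneg (ha n) _) hn (2 * n)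
    rwa [← Real.rpow_natCast, ← Real.rpow_mul (ha n), Nat.cast_mul, Nat.cast_ofNat,
      one_div, inv_mul_cancel₀ (by positivity), Real.rpow_one] at h2
  refine Summable.of_norm_bounded_eventually_nat
    (summable_geometric_of_lt_one (by norm_num : (0 : ℝ) ≤ 1 / 4) (by norm_num)) ?_
  filter_upwards [hb] with n hn
  have hf := Real.pow_div_factorial_le_exp (2 * n : ℝ) (by positivity) (2 * n)
  have hexp : Real.exp (2 * n : ℝ) = Real.exp 1 ^ (2 * n) := by
    rw [← Real.exp_nat_mul]; simp
  rw [norm_mul, norm_div, norm_pow, Real.norm_eq_abs, Real.norm_of_nonneg (ha n), Real.norm_natCast]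
  calc |t| ^ (2 * n) / ((2 * n).factorial : ℝ) * a n
      ≤ |t| ^ (2 * n) / ((2 * n).factorial : ℝ) * (ε * n) ^ (2 * n) := by gcongr
    _ = (|t| * ε / 2) ^ (2 * n) * ((2 * n : ℝ) ^ (2 * n) / (2 * n).factorial) := by
        simp only [mul_pow, div_pow]; field_simp
    _ ≤ (|t| * ε / 2) ^ (2 * n) * Real.exp 1 ^ (2 * n) := by rw [← hexp]; gcongr
    _ = ((|t| * ε * Real.exp 1) ^ 2 / 4) ^ n := by
        rw [← mul_pow, pow_mul]; congr 1; ring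
    _ ≤ (1 / 4) ^ n := by
        gcongr
        exact pow_le_one₀ (by positivity) hε'

theorem PolynomialsInL2.memLp_pow {N : Measure ℝ} (hN : PolynomialsInL2 N) (n : ℕ) :
    MemLp (fun x : ℝ => (x : ℂ) ^ n) 2 N := by
  simpa using hN (Polynomial.X ^ n)

theorem PolynomialsInL2.isFiniteMeasure {N : Measure ℝ} (hN : PolynomialsInL2 N) :
    IsFiniteMeasure N := by
  have h := hN.memLp_pow 0
  simp only [pow_zero] at h
  rcases (memLp_const_iff (by norm_num) (by norm_num)).1 h with h | h
  · exact absurd h one_ne_zero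
  · exact ⟨h⟩

theorem PolynomialsInL2.integrable_pow {N : Measure ℝ} (hN : PolynomialsInL2 N) (n : ℕ) :
    Integrable (fun x : ℝ => x ^ n) N := by
  have h := (MemLp.integrable_mul (hN.memLp_pow n) (hN.memLp_pow 0)).re
  refine h.congr (Eventually.of_forall fun x => ?_)
  simp [← Complex.ofReal_pow]

theorem moment_even_nonneg (N : Measure ℝ) (n : ℕ) : 0 ≤ moment N (2 * n) :=
  integral_nonneg fun x => by rw [pow_mul]; positivity

/-- Finiteness of all exponential moments. -/
def HasExpMoments (N : Measure ℝ) : Prop :=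
  ∀ t : ℝ, Integrable (fun x : ℝ => Real.exp (t * |x|)) N

theorem PolynomialsInL2.hasExpMoments {N : Measure ℝ} (hN : PolynomialsInL2 N)
    (h : (fun n : ℕ => moment N (2 * n) ^ (1 / (2 * (n : ℝ)))) =o[atTop] (fun n : ℕ => (n : ℝ))) :
    HasExpMoments N := by
  intro t
  have hs := summable_of_isLittleO (moment_even_nonneg N) h t
  have hterm : ∀ n : ℕ, ∫⁻ x : ℝ, ENNReal.ofReal ((t * x) ^ (2 * n) / (2 * n).factorial) ∂N
      = ENNReal.ofReal (t ^ (2 * n) / (2 * n).factorial * moment N (2 * n)) := by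
    intro n
    have hi : Integrable (fun x : ℝ => (t * x) ^ (2 * n) / (2 * n).factorial) N := by
      simp only [mul_pow]
      exact ((hN.integrable_pow (2 * n)).const_mul _).div_const _
    rw [← ofReal_integral_eq_lintegral_ofReal hi
      (Eventually.of_forall fun x => by
        change 0 ≤ (t * x) ^ (2 * n) / ((2 * n).factorial : ℝ)
        rw [pow_mul]; positivity)]
    congr 1
    rw [moment, ← integral_const_mul]
    congr 1; ext x; ring
  -- Only even moments are controlled, so the even series of `cosh` is integrated termwise; `exp (t
  -- * |x|) ≤ 2 * cosh (t * x)` does the rest.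
  have hcosh : Integrable (fun x : ℝ => Real.cosh (t * x)) N := by
    refine ⟨by fun_prop, ?_⟩
    rw [hasFiniteIntegral_iff_ofReal (Eventually.of_forall fun x => (Real.cosh_pos _).le)]
    have : ∀ x : ℝ, ENNReal.ofReal (Real.cosh (t * x)) =
        ∑' n : ℕ, ENNReal.ofReal ((t * x) ^ (2 * n) / (2 * n).factorial) := by
      intro x
      rw [← ENNReal.ofReal_tsum_of_nonneg (fun n => by rw [pow_mul]; positivity)
        (Real.hasSum_cosh _).summable, (Real.hasSum_cosh _).tsum_eq]
    simp only [this]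
    rw [lintegral_tsum (fun n => by fun_prop)]
    simp only [hterm]
    exact hs.tsum_ofReal_lt_top
  refine (hcosh.const_mul 2).mono' (by fun_prop) (Eventually.of_forall fun x => ?_)
  rw [Real.norm_of_nonneg (Real.exp_pos _).le, Real.cosh_eq]
  have h1 := Real.exp_pos (t * x)
  have h2 := Real.exp_pos (-(t * x))
  rcases abs_cases x with ⟨h, _⟩ | ⟨h, _⟩ <;> rw [h]
  · linarith
  · rw [mul_neg]; linarith

/-! ### Moment series of the Fourier transform, and determinacy -/

/-- The Fourier-Laplace transform of a density with exponential decay is given by its moments. -/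
theorem hasSum_integral_exp {N : Measure ℝ} {u : ℝ → ℂ}
    (hum : AEStronglyMeasurable u N) (t : ℂ)
    (hu : Integrable (fun x : ℝ => Real.exp (‖t‖ * |x|) * ‖u x‖) N) :
    HasSum (fun n : ℕ => t ^ n / n.factorial * ∫ x : ℝ, (x : ℂ) ^ n * u x ∂N)
      (∫ x : ℝ, Complex.exp (t * x) * u x ∂N) := by
  have hexp (x : ℝ) : HasSum (fun n : ℕ => (‖t‖ * |x|) ^ n / n.factorial)
      (Real.exp (‖t‖ * |x|)) := by
    rw [Real.exp_eq_exp_ℝ]; exact NormedSpace.expSeries_div_hasSum_exp _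
  have hc (x : ℝ) : HasSum (fun n : ℕ => (t * x) ^ n / n.factorial) (Complex.exp (t * x)) := by
    rw [Complex.exp_eq_exp_ℂ]; exact NormedSpace.expSeries_div_hasSum_exp _
  have := hasSum_integral_of_dominated_convergence (μ := N)
    (F := fun (n : ℕ) (x : ℝ) => (t * x) ^ n / n.factorial * u x)
    (f := fun x => Complex.exp (t * x) * u x)
    (fun n x => (‖t‖ * |x|) ^ n / n.factorial * ‖u x‖)
    (fun n => (Continuous.aestronglyMeasurable (by fun_prop)).mul hum)
    (fun n => Eventually.of_forall fun x => by simp)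
    (Eventually.of_forall fun x => (hexp x).summable.mul_right _)
    (hu.congr (Eventually.of_forall fun x => ((hexp x).mul_right _).tsum_eq.symm))
    (Eventually.of_forall fun x => (hc x).mul_right _)
  refine this.congr_fun fun n => ?_
  rw [← integral_const_mul]
  congr 1; ext x; ring

theorem eq_of_moment_eq {M N : Measure ℝ} (hM : PolynomialsInL2 M) (hN : PolynomialsInL2 N)
    (h : (fun n : ℕ => moment M (2 * n) ^ (1 / (2 * (n : ℝ)))) =o[atTop] (fun n : ℕ => (n : ℝ)))
    (hMN : ∀ n, moment N n = moment M n) : N = M := by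
  have := hM.isFiniteMeasure
  have := hN.isFiniteMeasure
  have eM := hM.hasExpMoments h
  have eN := hN.hasExpMoments (by simpa only [hMN] using h)
  refine Measure.ext_of_charFun (funext fun t => ?_)
  have key (P : Measure ℝ) (hP : HasExpMoments P) :
      HasSum (fun n : ℕ => (t * Complex.I) ^ n / n.factorial * (moment P n : ℂ)) (charFun P t) := by
    have := hasSum_integral_exp (N := P) (u := fun _ => 1) (by fun_prop) (t * Complex.I)
      (by simpa using hP |t|)
    rw [charFun_apply_real]
    convert this using 2 with n
    · simp only [mul_one, moment, ← Complex.ofReal_pow, integral_complex_ofReal]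
    · ext x; rw [mul_one]; congr 1; ring
  have h1 := key N eN
  simp only [hMN] at h1
  exact h1.unique (key M eM)

/-! ### Closability and the domain of the adjoint -/

/-- If `f` is closable, only `0` is orthogonal to the domain of the adjoint of `f`. -/
theorem eq_zero_of_isClosable {E F : Type*} [NormedAddCommGroup E] [InnerProductSpace ℂ E]
    [CompleteSpace E] [NormedAddCommGroup F] [InnerProductSpace ℂ F] [CompleteSpace F]
    {f : E →ₗ.[ℂ] F} (hf : f.IsClosable) {v : F}
    (hv : ∀ k : F, (∃ h : E, ∀ g : f.domain, inner ℂ h (g : E) = inner ℂ k (f g)) →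
      inner ℂ k v = 0) : v = 0 := by
  obtain ⟨f', hf'⟩ := hf
  -- In the Hilbert product, `w` is orthogonal to the graph exactly when `w.2` lies in the adjoint
  -- domain with image `-w.1`. Hence `(0, v)` is in the double orthogonal, the closure of the graph,
  -- which is itself a graph.
  let e := WithLp.prodContinuousLinearEquiv 2 ℂ E F
  let K : Submodule ℂ (WithLp 2 (E × F)) := f.graph.comap (e : WithLp 2 (E × F) →ₗ[ℂ] E × F)
  have hmem : WithLp.toLp 2 ((0 : E), v) ∈ Kᗮᗮ := by
    rw [Submodule.mem_orthogonal]
    intro w hw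
    rw [Submodule.mem_orthogonal'] at hw
    rw [WithLp.prod_inner_apply]
    simp only [inner_zero_right, zero_add]
    refine hv _ ⟨-w.ofLp.1, fun g => ?_⟩
    have := hw (WithLp.toLp 2 ((g : E), f g)) (by
      change ((g : E), f g) ∈ f.graph
      exact f.mem_graph g)
    rw [WithLp.prod_inner_apply] at this
    simp only at this
    rw [inner_neg_left]
    linear_combination -this
  rw [Submodule.orthogonal_orthogonal_eq_closure, ← SetLike.mem_coe,
    Submodule.topologicalClosure_coe] at hmem
  have h0 : ((0 : E), v) ∈ closure (f.graph : Set (E × F)) :=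
    map_mem_closure (f := e) e.continuous hmem fun x hx => hx
  have h1 : ((0 : E), v) ∈ f'.graph := by
    rw [← hf']; exact h0
  exact f'.graph_fst_eq_zero_snd h1 rfl

theorem toPolynomial_single (n : ℕ)
    (hn : lp.single (E := fun _ => ℂ) 2 n (1 : ℂ) ∈ finiteSequences) :
    toPolynomial ⟨lp.single 2 n 1, hn⟩ = Polynomial.X ^ n := by
  change (∑ᶠ m : ℕ, Polynomial.monomial m ((lp.single (E := fun _ => ℂ) 2 n (1 : ℂ)) m)) = _
  rw [finsum_eq_single _ n]
  · simp [Polynomial.X_pow_eq_monomial]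
  · intro m hm
    simp [hm]

/-- Functions in the domain of the adjoint of `A` have moments in `ℓ²`. -/
theorem integral_pow_mul_conj_eq {M : Measure ℝ} (hM : PolynomialsInL2 M) {k : Lp ℂ 2 M}
    {h : ℓ²(ℕ, ℂ)}
    (hk : ∀ g : (operatorA M hM).domain, inner ℂ h (g : ℓ²(ℕ, ℂ)) = inner ℂ k (operatorA M hM g))
    (n : ℕ) : ∫ x : ℝ, (x : ℂ) ^ n * (starRingEnd ℂ) (k x) ∂M = (starRingEnd ℂ) (h n) := by
  have hn : lp.single (E := fun _ => ℂ) 2 n (1 : ℂ) ∈ finiteSequences := by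
    refine (Set.finite_singleton n).subset fun m hm => ?_
    by_contra hne
    exact hm (by simpa using Pi.single_eq_of_ne (M := fun _ => ℂ) hne 1)
  have h1 := hk ⟨_, hn⟩
  have h2 : operatorA M hM ⟨_, hn⟩ = polynomialToL2 M hM (toPolynomial ⟨_, hn⟩) := rfl
  rw [h2, toPolynomial_single, L2.inner_def, lp.inner_single_right] at h1
  simp only [RCLike.inner_apply, one_mul] at h1
  rw [h1]
  refine integral_congr_ae ?_
  filter_upwards [(hM (Polynomial.X ^ n)).coeFn_toLp] with x hx
  change _ = ((hM (Polynomial.X ^ n)).toLp (fun x : ℝ => (Polynomial.X ^ n).eval (x : ℂ))) x * _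
  rw [hx]
  simp

theorem HasExpMoments.integrable_exp_mul {M : Measure ℝ} (hM : HasExpMoments M) {u : ℝ → ℂ}
    (hu : MemLp u 2 M) (t : ℝ) : Integrable (fun x : ℝ => Real.exp (t * |x|) * ‖u x‖) M := by
  have h : MemLp (fun x : ℝ => Real.exp (t * |x|)) 2 M := by
    rw [memLp_two_iff_integrable_sq (by fun_prop)]
    refine (hM (2 * t)).congr (Eventually.of_forall fun x => ?_)
    simp only [← Real.exp_nat_mul]
    congr 1; push_cast; ring
  exact MemLp.integrable_mul h hu.norm

/-! ### Laplace integrals of powers -/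

theorem integrableOn_pow_mul_exp_neg (n : ℕ) {r : ℝ} (hr : 0 < r) :
    IntegrableOn (fun t : ℝ => t ^ n * Real.exp (-r * t)) (Set.Ioi 0) := by
  have := integrableOn_rpow_mul_exp_neg_mul_rpow (p := 1) (s := n) (b := r)
    (by have := n.cast_nonneg (α := ℝ); linarith) one_pos hr
  simpa using this

theorem integral_pow_mul_exp_neg (n : ℕ) {r : ℝ} (hr : 0 < r) :
    ∫ t : ℝ in Set.Ioi 0, t ^ n * Real.exp (-r * t) = n.factorial / r ^ (n + 1) := by
  have := Real.integral_rpow_mul_exp_neg_mul_Ioi (a := n + 1) (r := r) (by positivity) hr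
  rw [Real.Gamma_nat_eq_factorial] at this
  simp only [add_sub_cancel_right, Real.rpow_natCast] at this
  have e : (1 / r) ^ ((n : ℝ) + 1) = 1 / r ^ (n + 1) := by
    rw [← Nat.cast_succ, Real.rpow_natCast]; simp
  rw [e] at this
  simp only [neg_mul]
  rw [this]; ring

theorem integral_pow_mul_cexp_neg (n : ℕ) {s : ℂ} (hs : 0 < s.re) :
    ∫ t : ℝ in Set.Ioi 0, (t : ℂ) ^ n * Complex.exp (-s * t) = n.factorial / s ^ (n + 1) := by
  have hs0 : s ≠ 0 := by rintro rfl; simp at hs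
  have hnorm (m : ℕ) (t : ℝ) (ht : 0 ≤ t) :
      ‖(t : ℂ) ^ m * Complex.exp (-s * t)‖ = t ^ m * Real.exp (-s.re * t) := by
    simp [Complex.norm_exp, abs_of_nonneg ht]
  have hint (m : ℕ) : IntegrableOn (fun t : ℝ => (t : ℂ) ^ m * Complex.exp (-s * t))
      (Set.Ioi 0) := by
    refine (integrableOn_pow_mul_exp_neg m hs).mono'
      (Continuous.aestronglyMeasurable (by fun_prop)) ?_
    refine (ae_restrict_mem measurableSet_Ioi).mono fun t ht => (hnorm m t (le_of_lt ht)).le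
  have hd (t : ℝ) : HasDerivAt (fun t : ℝ => Complex.exp (-s * t))
      (Complex.exp (-s * t) * -s) t := by
    have := ((hasDerivAt_id (t : ℂ)).const_mul (-s)).cexp.comp_ofReal
    simpa using this
  have hlim (m : ℕ) : Tendsto (fun t : ℝ => (t : ℂ) ^ m * Complex.exp (-s * t)) atTop (nhds 0) := by
    rw [tendsto_zero_iff_norm_tendsto_zero]
    have := tendsto_rpow_mul_exp_neg_mul_atTop_nhds_zero m s.re hs
    refine this.congr' ?_
    filter_upwards [eventually_ge_atTop 0] with t ht
    rw [hnorm m t ht, Real.rpow_natCast]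
  induction n with
  | zero =>
    have := integral_exp_mul_complex_Ioi (a := -s) (by simpa using hs) 0
    simpa using this
  | succ n ih =>
    have hd' : ∀ t ∈ Set.Ici (0 : ℝ), HasDerivAt
        (fun t : ℝ => (t : ℂ) ^ (n + 1) * Complex.exp (-s * t))
        ((n + 1) * ((t : ℂ) ^ n * Complex.exp (-s * t)) -
          s * ((t : ℂ) ^ (n + 1) * Complex.exp (-s * t))) t := by
      intro t _
      have h1 : HasDerivAt (fun t : ℝ => (t : ℂ) ^ (n + 1)) ((n + 1) * (t : ℂ) ^ n) t := by
        simpa using (hasDerivAt_pow (n + 1) (t : ℂ)).comp_ofReal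
      exact (h1.mul (hd t)).congr_deriv (by ring)
    have := integral_Ioi_of_hasDerivAt_of_tendsto' hd'
      (((hint n).const_mul _).sub ((hint (n + 1)).const_mul _)) (hlim (n + 1))
    rw [integral_sub ((hint n).const_mul _) ((hint (n + 1)).const_mul _),
      integral_const_mul, integral_const_mul, ih] at this
    simp only [Complex.ofReal_zero, ne_eq, Nat.add_eq_zero_iff, one_ne_zero, and_false,
      not_false_eq_true, zero_pow, zero_mul, sub_zero, sub_eq_zero] at this
    have h2 := congrArg (fun z => z / s) this
    simp only [mul_div_cancel_left₀ _ hs0] at h2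
    rw [← h2, Nat.factorial_succ]
    push_cast
    field_simp
    ring

/-! ### The Cauchy transform and its expansion at infinity -/

/-- The Cauchy transform of the complex measure `u dM`. -/
def cauchyTransform (M : Measure ℝ) (u : ℝ → ℂ) (w : ℂ) : ℂ := ∫ x : ℝ, (w - x)⁻¹ * u x ∂M

/-- The formal expansion at infinity of a Cauchy transform with moments `ν`. -/
def momentSeries (ν : ℕ → ℂ) (w : ℂ) : ℂ := ∑' n : ℕ, ν n * w⁻¹ ^ (n + 1)

/-- The resolvent kernel is a Laplace integral of `exp (-τ * (w - x) * t)`. As `τ` is imaginary,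
`exp (τ * t * x)` has modulus one, so Fubini needs only integrability of `u`. -/
theorem cauchyTransform_eq_laplace {M : Measure ℝ} [SFinite M] {u : ℝ → ℂ} (hu : Integrable u M)
    {τ w : ℂ} (hτ : τ.re = 0) (hw : 0 < (τ * w).re) :
    cauchyTransform M u w = τ * ∫ t : ℝ in Set.Ioi 0, Complex.exp (-(τ * w) * t) *
      ∫ x : ℝ, Complex.exp (τ * t * x) * u x ∂M := by
  have hτ0 : τ ≠ 0 := by rintro rfl; simp at hw
  have hint : Integrable (Function.uncurry fun (t x : ℝ) =>
      Complex.exp (-(τ * w) * t) * (Complex.exp (τ * t * x) * u x))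
      ((volume.restrict (Set.Ioi 0)).prod M) := by
    have h1 : Integrable (fun t : ℝ => Real.exp (-(τ * w).re * t))
        (volume.restrict (Set.Ioi 0)) := by
      simpa only [pow_zero, one_mul, IntegrableOn] using integrableOn_pow_mul_exp_neg 0 hw
    refine (h1.mul_prod hu.norm).mono' ?_ (Eventually.of_forall fun p => ?_)
    · have h2 : AEStronglyMeasurable (fun p : ℝ × ℝ => u p.2)
          ((volume.restrict (Set.Ioi 0)).prod M) := hu.aestronglyMeasurable.comp_snd
      exact (Continuous.aestronglyMeasurable (by fun_prop)).mul
        ((Continuous.aestronglyMeasurable (by fun_prop)).mul h2)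
    · simp [Function.uncurry, Complex.norm_exp, hτ]
  simp only [← integral_const_mul]
  rw [integral_integral_swap (by
    simpa [Function.uncurry_def] using hint.const_mul τ)]
  refine integral_congr_ae (Eventually.of_forall fun x => ?_)
  have hre : (-(τ * (w - x))).re < 0 := by
    simp [hτ] at hw ⊢; linarith
  have hwx : w - x ≠ 0 := by intro h; rw [h] at hre; simp at hre
  have h3 := integral_exp_mul_complex_Ioi hre 0
  calc (w - x)⁻¹ * u x
      = τ * u x * ∫ t : ℝ in Set.Ioi 0, Complex.exp (-(τ * (w - x)) * t) := by
        rw [h3]; simp; field_simp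
    _ = _ := by
        rw [← integral_const_mul]
        congr 1; ext t
        rw [show -(τ * (w - x)) * (t : ℂ) = -(τ * w) * t + τ * t * x by ring, Complex.exp_add]
        ring

/-- Termwise integration of the moment series in the Laplace formula: the `n`-th term has L¹ norm
`‖ν n‖ / (τ * w).re ^ (n + 1)`, summable for bounded moments when `1 < (τ * w).re`. -/
theorem cauchyTransform_eq_momentSeries_of_one_lt {M : Measure ℝ} [SFinite M] {u : ℝ → ℂ}
    (hu : ∀ t : ℝ, Integrable (fun x : ℝ => Real.exp (t * |x|) * ‖u x‖) M)
    (hum : AEStronglyMeasurable u M) {B : ℝ}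
    (hν : ∀ n : ℕ, ‖∫ x : ℝ, (x : ℂ) ^ n * u x ∂M‖ ≤ B)
    {τ w : ℂ} (hτ : τ.re = 0) (hτ1 : ‖τ‖ = 1) (hw : 1 < (τ * w).re) :
    cauchyTransform M u w = momentSeries (fun n => ∫ x : ℝ, (x : ℂ) ^ n * u x ∂M) w := by
  have hw0 : 0 < (τ * w).re := one_pos.trans hw
  have hτ0 : τ ≠ 0 := by rintro rfl; simp at hw0
  have hw00 : w ≠ 0 := by rintro rfl; simp at hw0
  set ν : ℕ → ℂ := fun n => ∫ x : ℝ, (x : ℂ) ^ n * u x ∂M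
  have hui : Integrable u M := by
    rw [← integrable_norm_iff hum]; simpa using hu 0
  rw [cauchyTransform_eq_laplace hui hτ hw0]
  have hS (t : ℝ) := hasSum_integral_exp hum (τ * t) (hu _)
  let F : ℕ → ℝ → ℂ := fun n t => (τ ^ n * ν n / n.factorial) *
    ((t : ℂ) ^ n * Complex.exp (-(τ * w) * t))
  have hnorm (n : ℕ) (t : ℝ) (ht : 0 ≤ t) : ‖F n t‖ = ‖ν n‖ / n.factorial *
      (t ^ n * Real.exp (-(τ * w).re * t)) := by
    simp only [F, norm_mul, norm_div, norm_pow, hτ1, Complex.norm_exp, Complex.norm_natCast]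
    have hre : (-(τ * w) * t).re = -(τ * w).re * t := by simp; ring
    rw [hre, Complex.norm_real, Real.norm_of_nonneg ht, one_pow]
    ring
  have hFint (n : ℕ) : IntegrableOn (F n) (Set.Ioi 0) := by
    refine ((integrableOn_pow_mul_exp_neg n hw0).const_mul (‖ν n‖ / n.factorial)).mono'
      (Continuous.aestronglyMeasurable (by fun_prop)) ?_
    exact (ae_restrict_mem measurableSet_Ioi).mono fun t ht => (hnorm n t (le_of_lt ht)).le
  have hFn (n : ℕ) : ∫ t : ℝ in Set.Ioi 0, ‖F n t‖ = ‖ν n‖ * ((τ * w).re⁻¹) ^ (n + 1) := by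
    rw [setIntegral_congr_fun measurableSet_Ioi fun t ht => hnorm n t (le_of_lt ht),
      integral_const_mul, integral_pow_mul_exp_neg n hw0]
    have := Nat.factorial_ne_zero n
    rw [inv_pow]
    field_simp
  have hsum : Summable fun n => ∫ t : ℝ in Set.Ioi 0, ‖F n t‖ := by
    simp only [hFn]
    have hg := (summable_geometric_of_lt_one (inv_nonneg.2 hw0.le) (inv_lt_one_of_one_lt₀ hw))
    refine Summable.of_nonneg_of_le (fun n => by positivity) (fun n => ?_)
      (((summable_nat_add_iff 1).2 hg).mul_left B)
    exact mul_le_mul_of_nonneg_right (hν n) (by positivity)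
  have hmain := hasSum_integral_of_summable_integral_norm hFint hsum
  have hinner (t : ℝ) : ∑' n, F n t = Complex.exp (-(τ * w) * t) *
      ∫ x : ℝ, Complex.exp (τ * t * x) * u x ∂M := by
    refine ((hS t).mul_left (Complex.exp (-(τ * w) * t))).tsum_eq ▸ tsum_congr fun n => ?_
    simp only [F, ν]; ring
  simp only [hinner] at hmain
  rw [← (hmain.mul_left τ).tsum_eq]
  refine tsum_congr fun n => ?_
  simp only [F]
  rw [integral_const_mul, integral_pow_mul_cexp_neg n hw0, mul_pow]
  have := Nat.factorial_ne_zero n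
  rw [inv_pow]
  field_simp
  ring

theorem abs_im_le_norm_sub_ofReal (w : ℂ) (x : ℝ) : |w.im| ≤ ‖w - x‖ := by
  simpa using Complex.abs_im_le_norm (w - x)

theorem differentiableAt_cauchyTransform {M : Measure ℝ} {u : ℝ → ℂ} (hu : Integrable u M)
    {w : ℂ} (hw : w.im ≠ 0) : DifferentiableAt ℂ (cauchyTransform M u) w := by
  have hδ : 0 < |w.im| / 2 := by positivity
  have him : ∀ z ∈ Metric.ball w (|w.im| / 2), |w.im| / 2 ≤ |z.im| := by
    intro z hz
    have h1 := Complex.abs_im_le_norm (w - z)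
    rw [Metric.mem_ball', dist_eq_norm] at hz
    have h2 := abs_sub_abs_le_abs_sub w.im z.im
    rw [Complex.sub_im] at h1
    linarith
  have hne : ∀ z ∈ Metric.ball w (|w.im| / 2), ∀ x : ℝ, z - x ≠ 0 := by
    intro z hz x
    rw [← norm_pos_iff]
    linarith [him z hz, abs_im_le_norm_sub_ofReal z x]
  have hm (z : ℂ) : AEStronglyMeasurable (fun x : ℝ => (z - x)⁻¹ * u x) M :=
    (Measurable.aestronglyMeasurable (by fun_prop)).mul hu.aestronglyMeasurable
  have hball := Metric.ball_mem_nhds w hδ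
  refine (hasDerivAt_integral_of_dominated_loc_of_deriv_le
    (F' := fun z x => -1 / (z - x) ^ 2 * u x)
    (bound := fun x => 1 / (|w.im| / 2) ^ 2 * ‖u x‖) hball
    (Eventually.of_forall hm) ?_ ?_ ?_ (hu.norm.const_mul _) ?_).2.differentiableAt
  · refine (hu.norm.const_mul (|w.im| / 2)⁻¹).mono' (hm w) (Eventually.of_forall fun x => ?_)
    rw [norm_mul, norm_inv]
    gcongr
    linarith [abs_im_le_norm_sub_ofReal w x]
  · exact (Measurable.aestronglyMeasurable (by fun_prop)).mul hu.aestronglyMeasurable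
  · refine Eventually.of_forall fun x z hz => ?_
    rw [norm_mul, norm_div, norm_neg, norm_one, norm_pow]
    gcongr
    exact (him z hz).trans (abs_im_le_norm_sub_ofReal z x)
  · refine Eventually.of_forall fun x z hz => ?_
    have h1 : HasDerivAt (fun z : ℂ => z - x) 1 z := (hasDerivAt_id z).sub_const _
    exact (h1.inv (hne z hz x)).mul_const (u x)

theorem differentiableAt_momentSeries {ν : ℕ → ℂ} {B : ℝ} (hν : ∀ n, ‖ν n‖ ≤ B) {w : ℂ}
    (hw : 1 < ‖w‖) : DifferentiableAt ℂ (momentSeries ν) w := by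
  obtain ⟨R, hR1, hR⟩ := exists_between hw
  have hR0 : 0 < R := one_pos.trans hR1
  have hB : 0 ≤ B := (norm_nonneg _).trans (hν 0)
  have hopen : IsOpen {z : ℂ | R < ‖z‖} := isOpen_lt continuous_const continuous_norm
  have hg := (summable_geometric_of_lt_one (inv_nonneg.2 hR0.le) (inv_lt_one_of_one_lt₀ hR1))
  have : DifferentiableOn ℂ (momentSeries ν) {z : ℂ | R < ‖z‖} := by
    refine Complex.differentiableOn_tsum_of_summable_norm
      (((summable_nat_add_iff 1).2 hg).mul_left B) (fun n z hz => ?_) hopen fun n z hz => ?_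
    · have hz0 : z ≠ 0 := norm_pos_iff.1 (hR0.trans hz)
      exact ((((differentiableAt_id).inv hz0).pow (n + 1)).const_mul _).differentiableWithinAt
    · rw [norm_mul, norm_pow, norm_inv]
      gcongr
      · exact hν n
      · exact le_of_lt hz
  exact this.differentiableAt (hopen.mem_nhds hR)

/-- The Cauchy transform is given by its expansion on the two sides of the unit disc. -/
theorem cauchyTransform_eq_momentSeries {M : Measure ℝ} [SFinite M] {u : ℝ → ℂ}
    (hu : ∀ t : ℝ, Integrable (fun x : ℝ => Real.exp (t * |x|) * ‖u x‖) M)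
    (hum : AEStronglyMeasurable u M) {B : ℝ}
    (hν : ∀ n : ℕ, ‖∫ x : ℝ, (x : ℂ) ^ n * u x ∂M‖ ≤ B)
    {w : ℂ} (him : w.im ≠ 0) (hre : 1 < |w.re|) :
    cauchyTransform M u w = momentSeries (fun n => ∫ x : ℝ, (x : ℂ) ^ n * u x ∂M) w := by
  have hui : Integrable u M := by
    rw [← integrable_norm_iff hum]; simpa using hu 0
  obtain ⟨σ, hσ, hσw⟩ : ∃ σ : ℝ, |σ| = 1 ∧ 0 < σ * w.im := by
    rcases him.lt_or_gt with h | h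
    · exact ⟨-1, by simp, by linarith⟩
    · exact ⟨1, by simp, by linarith⟩
  obtain ⟨ρ, hρ, hρw⟩ : ∃ ρ : ℝ, |ρ| = 1 ∧ 1 < ρ * w.re := by
    rcases lt_abs.1 hre with h | h
    · exact ⟨1, by simp, by linarith⟩
    · exact ⟨-1, by simp, by linarith⟩
  have hσ2 : σ * σ = 1 := by rw [← abs_mul_abs_self, hσ, one_mul]
  -- A convex region containing `w` on which both sides are holomorphic. It reaches `1 < |z.im|`,
  -- where the Laplace argument applies with `τ = -σ * I`, as `(τ * z).re = σ * z.im`; the identity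
  -- theorem carries equality to `w`.
  let U : Set ℂ := {z | 0 < σ * z.im ∧ 1 < ρ * z.re}
  have hU : IsOpen U := by
    exact (isOpen_lt continuous_const (continuous_const.mul Complex.continuous_im)).inter
      (isOpen_lt continuous_const (continuous_const.mul Complex.continuous_re))
  have hUc : Convex ℝ U := by
    have h1 : Convex ℝ {z : ℂ | 0 < (σ • Complex.imLm) z} :=
      (convex_Ioi (0 : ℝ)).linear_preimage (σ • Complex.imLm)
    have h2 : Convex ℝ {z : ℂ | 1 < (ρ • Complex.reLm) z} :=
      (convex_Ioi (1 : ℝ)).linear_preimage (ρ • Complex.reLm)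
    exact h1.inter h2
  have hC : DifferentiableOn ℂ (cauchyTransform M u) U := fun z hz =>
    (differentiableAt_cauchyTransform hui
      (right_ne_zero_of_mul hz.1.ne')).differentiableWithinAt
  have hG : DifferentiableOn ℂ (momentSeries fun n => ∫ x : ℝ, (x : ℂ) ^ n * u x ∂M) U :=
    fun z hz => by
      refine (differentiableAt_momentSeries hν ?_).differentiableWithinAt
      have h1 := Complex.abs_re_le_norm z
      have h2 := (le_abs_self (ρ * z.re)).trans_eq (abs_mul _ _)
      rw [hρ, one_mul] at h2
      linarith [hz.2]
  let z₀ : ℂ := ⟨w.re, σ * 2⟩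
  have hz₀ : z₀ ∈ U := ⟨by change 0 < σ * (σ * 2); rw [← mul_assoc, hσ2]; norm_num, hρw⟩
  have hV : {z : ℂ | 1 < σ * z.im} ∈ nhds z₀ := by
    refine (isOpen_lt continuous_const (continuous_const.mul Complex.continuous_im)).mem_nhds ?_
    change 1 < σ * (σ * 2)
    rw [← mul_assoc, hσ2]; norm_num
  refine AnalyticOnNhd.eqOn_of_preconnected_of_eventuallyEq (hC.analyticOnNhd hU)
    (hG.analyticOnNhd hU) hUc.isPreconnected hz₀ ?_ ⟨hσw, hρw⟩
  filter_upwards [hV] with z hz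
  refine cauchyTransform_eq_momentSeries_of_one_lt hu hum hν (τ := -σ * Complex.I)
    (by simp) (by simp [hσ]) ?_
  simpa using hz

/-! ### Contour integrals and vanishing beyond the unit interval -/

/-- Cauchy transform against a contour that crosses the real line at `c - r` and `c + r`. -/
theorem circleIntegral_cauchyTransform {M : Measure ℝ} [SFinite M] {u : ℝ → ℂ}
    (hu : Integrable u M) {F : ℂ → ℂ} (hF : Differentiable ℂ F) {c r : ℝ} (hr : 0 < r) :
    ∮ w in C(c, r), F w * ((w - c) ^ 2 - r ^ 2) * cauchyTransform M u w =
      ∫ x : ℝ, (Set.Ioo (c - r) (c + r)).indicator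
        (fun x => 2 * Real.pi * Complex.I * (F x * ((x - c) ^ 2 - r ^ 2))) x * u x ∂M := by
  have hsphere (θ : ℝ) : ‖circleMap c r θ - c‖ = r := by simp [abs_of_pos hr]
  let P : ℂ → ℂ := fun w => F w * ((w - c) ^ 2 - r ^ 2)
  have hP : Differentiable ℂ P := by fun_prop
  obtain ⟨K, hK⟩ : ∃ K, ∀ θ : ℝ, ‖F (circleMap c r θ)‖ ≤ K := by
    obtain ⟨K, hK⟩ := (isCompact_sphere (c : ℂ) r).exists_bound_of_continuousOn
      hF.continuous.continuousOn
    exact ⟨K, fun θ => hK _ (circleMap_mem_sphere _ hr.le θ)⟩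
  have hK0 : 0 ≤ K := (norm_nonneg _).trans (hK 0)
  -- On `‖z‖ = r`, `z ^ 2 - r ^ 2 = z * (z - conj z)`. This compensates `‖w - x‖⁻¹ ≤ |w.im|⁻¹`, so
  -- the kernel stays bounded where the circle crosses the real line, and Fubini applies.
  have hfactor (θ : ℝ) : ‖(circleMap c r θ - c) ^ 2 - (r : ℂ) ^ 2‖ = 2 * r * |(circleMap c r θ).im| := by
    set z := circleMap c r θ - c with hz
    have him : (circleMap c r θ).im = z.im := by
      rw [hz, Complex.sub_im, Complex.ofReal_im, sub_zero]
    have h1 : (r : ℂ) ^ 2 = z * (starRingEnd ℂ) z := by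
      rw [Complex.mul_conj, Complex.normSq_eq_norm_sq, hsphere]; simp
    have h2 : z ^ 2 - (r : ℂ) ^ 2 = z * (2 * z.im * Complex.I) := by
      rw [h1, pow_two, ← mul_sub, Complex.sub_conj]; push_cast; ring
    rw [h2, him]
    have h3 : ‖z‖ = r := hsphere θ
    simp only [norm_mul, h3, Complex.norm_I, Complex.norm_real, Real.norm_eq_abs,
      Complex.norm_ofNat]
    ring
  have hbound (θ x : ℝ) :
      ‖deriv (circleMap c r) θ * (P (circleMap c r θ) * (circleMap c r θ - x)⁻¹)‖
        ≤ r * (K * (2 * r)) := by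
    rw [norm_mul, deriv_circleMap, norm_mul, norm_circleMap_zero, Complex.norm_I, mul_one,
      abs_of_pos hr, norm_mul, norm_mul, hfactor, mul_assoc, norm_inv]
    refine mul_le_mul_of_nonneg_left (mul_le_mul (hK θ) ?_ (by positivity) hK0) hr.le
    rw [← div_eq_mul_inv]
    refine div_le_of_le_mul₀ (norm_nonneg _) (by positivity) ?_
    gcongr
    exact abs_im_le_norm_sub_ofReal _ x
  have hint : Integrable (Function.uncurry fun (θ x : ℝ) =>
      deriv (circleMap c r) θ * (P (circleMap c r θ) * (circleMap c r θ - x)⁻¹) * u x)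
      ((volume.restrict (Set.Ioc 0 (2 * Real.pi))).prod M) := by
    have h1 : Integrable (fun p : ℝ × ℝ => (r * (K * (2 * r))) * ‖u p.2‖)
        ((volume.restrict (Set.Ioc 0 (2 * Real.pi))).prod M) :=
      (integrable_const (r * (K * (2 * r)))).mul_prod hu.norm
    refine h1.mono' ?_ (Eventually.of_forall fun p => ?_)
    · have h2 : AEStronglyMeasurable (fun p : ℝ × ℝ => u p.2)
          ((volume.restrict (Set.Ioc 0 (2 * Real.pi))).prod M) := hu.aestronglyMeasurable.comp_snd
      refine AEStronglyMeasurable.mul (Measurable.aestronglyMeasurable ?_) h2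
      have hPm : Measurable P := hP.continuous.measurable
      simp only [deriv_circleMap]
      have hcm : Measurable (fun θ : ℝ => circleMap (c : ℂ) r θ) :=
        (continuous_circleMap _ _).measurable
      have hcm0 : Measurable (fun θ : ℝ => circleMap 0 r θ) :=
        (continuous_circleMap _ _).measurable
      fun_prop
    · simp only [Function.uncurry, norm_mul _ (u p.2)]
      gcongr
      exact hbound _ _
  have hcircle (x : ℝ) : ∮ w in C(c, r), P w * (w - x)⁻¹ =
      (Set.Ioo (c - r) (c + r)).indicator (fun x : ℝ => 2 * Real.pi * Complex.I * P x) x := by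
    by_cases hx : x ∈ Set.Ioo (c - r) (c + r)
    · rw [Set.indicator_of_mem hx]
      have hxb : (x : ℂ) ∈ Metric.ball (c : ℂ) r := by
        rw [mem_ball_iff_norm, ← Complex.ofReal_sub, Complex.norm_real, Real.norm_eq_abs, abs_lt]
        constructor <;> linarith [hx.1, hx.2]
      have := DiffContOnCl.circleIntegral_sub_inv_smul (f := P) hP.diffContOnCl hxb
      simpa only [smul_eq_mul, mul_comm _ (P _)] using this
    rw [Set.indicator_of_notMem hx]
    -- At a crossing point the pole cancels: the integrand is `F w * (w + x - 2 * c)` except at `w =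
    -- x`.
    by_cases hx2 : (x - c) ^ 2 = r ^ 2
    · have hQ : ∮ w in C(c, r), F w * (w + x - 2 * c) = 0 := by
        refine Complex.circleIntegral_eq_zero_of_differentiable_on_off_countable hr.le
          Set.countable_empty (hF.continuous.mul (by fun_prop)).continuousOn fun z _ => ?_
        fun_prop
      rw [← hQ]
      refine circleIntegral.circleIntegral_congr_codiscreteWithin ?_ hr.ne'
      filter_upwards [codiscreteWithin_mono (Set.subset_univ _)
        (Set.finite_singleton (x : ℂ)).compl_mem_codiscrete] with w hw
      have hwx : w - x ≠ 0 := sub_ne_zero.2 hw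
      have hx3 : (r : ℂ) ^ 2 = (x - c) ^ 2 := by exact_mod_cast hx2.symm
      simp only [P, hx3]
      field_simp
      ring
    · have hd : ∀ w ∈ Metric.closedBall (c : ℂ) r,
          DifferentiableAt ℂ (fun w => P w * (w - x)⁻¹) w := by
        intro w hw
        refine (hP w).mul (DifferentiableAt.inv (by fun_prop) (sub_ne_zero.2 ?_))
        rintro rfl
        rw [mem_closedBall_iff_norm, ← Complex.ofReal_sub, Complex.norm_real,
          Real.norm_eq_abs] at hw
        have hlt : |x - c| < r := lt_of_le_of_ne hw fun h => hx2 (by rw [← h, sq_abs])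
        rw [abs_lt] at hlt
        exact hx ⟨by linarith, by linarith⟩
      exact Complex.circleIntegral_eq_zero_of_differentiable_on_off_countable hr.le
        Set.countable_empty (fun w hw => (hd w hw).continuousAt.continuousWithinAt)
        fun w hw => hd w (Metric.ball_subset_closedBall hw.1)
  have h2π : (0 : ℝ) ≤ 2 * Real.pi := by positivity
  calc ∮ w in C(c, r), P w * cauchyTransform M u w
      = ∫ θ in Set.Ioc 0 (2 * Real.pi), ∫ x : ℝ, deriv (circleMap c r) θ *
          (P (circleMap c r θ) * (circleMap c r θ - x)⁻¹) * u x ∂M := by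
        rw [circleIntegral, intervalIntegral.integral_of_le h2π]
        congr 1; ext θ
        simp only [cauchyTransform, smul_eq_mul, ← integral_const_mul]
        congr 1; ext x; ring
    _ = ∫ x : ℝ, (∮ w in C(c, r), P w * (w - x)⁻¹) * u x ∂M := by
        rw [integral_integral_swap hint]
        congr 1; ext x
        rw [circleIntegral, intervalIntegral.integral_of_le h2π, ← integral_mul_const]
        simp only [smul_eq_mul]
    _ = _ := by simp only [hcircle]; rfl

/-- An integrable function on a bounded interval that is orthogonal to all polynomials is zero. -/
theorem ae_eq_zero_of_integral_polynomial {M : Measure ℝ} {f : ℝ → ℂ} (hf : Integrable f M)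
    {a b : ℝ} (hsupp : ∀ x ∉ Set.Icc a b, f x = 0)
    (h : ∀ p : Polynomial ℝ, ∫ x : ℝ, ((p.eval x : ℝ) : ℂ) * f x ∂M = 0) :
    ∀ᵐ x ∂M, f x = 0 := by
  have hbdd (g : ℝ → ℝ) (hg : ContinuousOn g (Set.Icc a b)) (hgm : Measurable g) :
      Integrable (fun x => (g x : ℂ) * f x) M := by
    obtain ⟨K, hK⟩ := isCompact_Icc.exists_bound_of_continuousOn hg
    refine (hf.norm.const_mul K).mono'
      ((Measurable.aestronglyMeasurable (by fun_prop)).mul hf.aestronglyMeasurable)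
      (Eventually.of_forall fun x => ?_)
    by_cases hx : x ∈ Set.Icc a b
    · rw [norm_mul, Complex.norm_real]
      gcongr
      exact hK x hx
    · simp [hsupp x hx]
  refine ae_eq_zero_of_integral_contDiff_smul_eq_zero hf.locallyIntegrable fun g hg _ => ?_
  have hgc := hg.continuous
  simp only [Complex.real_smul]
  set J := ∫ x, (g x : ℂ) * f x ∂M
  have hle : ∀ ε : ℝ, 0 < ε → ‖J‖ ≤ ε * ∫ x, ‖f x‖ ∂M := by
    intro ε hε
    obtain ⟨p, hp⟩ := exists_polynomial_near_of_continuousOn a b g hgc.continuousOn ε hε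
    have hJ : J = -∫ x, ((p.eval x - g x : ℝ) : ℂ) * f x ∂M := by
      simp only [Complex.ofReal_sub, sub_mul]
      rw [integral_sub (hbdd _ p.continuous.continuousOn p.continuous.measurable)
        (hbdd _ hgc.continuousOn hgc.measurable), h p, zero_sub, neg_neg]
    rw [hJ, norm_neg, ← integral_const_mul]
    refine norm_integral_le_of_norm_le (hf.norm.const_mul ε) (Eventually.of_forall fun x => ?_)
    by_cases hx : x ∈ Set.Icc a b
    · rw [norm_mul, Complex.norm_real]
      gcongr
      exact (hp x hx).le
    · simp [hsupp x hx]
  rw [← norm_le_zero_iff]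
  refine le_of_forall_pos_le_add fun δ hδ => ?_
  have hI : 0 ≤ ∫ x, ‖f x‖ ∂M := integral_nonneg fun x => norm_nonneg _
  refine (hle (δ / ((∫ x, ‖f x‖ ∂M) + 1)) (by positivity)).trans ?_
  rw [zero_add, div_mul_eq_mul_div, div_le_iff₀ (by positivity)]
  nlinarith

/-- The moment series is holomorphic on the closed disc and may replace the Cauchy transform on its
boundary, so the weighted contour integrals vanish. Hence `((x - c) ^ 2 - r ^ 2) * u` is orthogonal
to all polynomials on the interval, and the weight has no zero inside. -/
theorem ae_eq_zero_on_Ioo {M : Measure ℝ} [SFinite M] {u : ℝ → ℂ}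
    (hu : ∀ t : ℝ, Integrable (fun x : ℝ => Real.exp (t * |x|) * ‖u x‖) M)
    (hum : AEStronglyMeasurable u M) {B : ℝ}
    (hν : ∀ n : ℕ, ‖∫ x : ℝ, (x : ℂ) ^ n * u x ∂M‖ ≤ B) {c r : ℝ} (hr : 0 < r)
    (hc : 1 + r < |c|) : ∀ᵐ x ∂M, x ∈ Set.Ioo (c - r) (c + r) → u x = 0 := by
  have hui : Integrable u M := by
    rw [← integrable_norm_iff hum]; simpa using hu 0
  have hre : ∀ w ∈ Metric.closedBall (c : ℂ) r, 1 < |w.re| := by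
    intro w hw
    rw [mem_closedBall_iff_norm'] at hw
    have h1 := Complex.abs_re_le_norm ((c : ℂ) - w)
    have h2 := abs_sub_abs_le_abs_sub c w.re
    rw [Complex.sub_re, Complex.ofReal_re] at h1
    linarith
  set G := momentSeries fun n => ∫ x : ℝ, (x : ℂ) ^ n * u x ∂M
  have hcirc (F : ℂ → ℂ) (hF : Differentiable ℂ F) :
      ∮ w in C(c, r), F w * ((w - c) ^ 2 - r ^ 2) * cauchyTransform M u w = 0 := by
    have hd : ∀ w ∈ Metric.closedBall (c : ℂ) r,
        DifferentiableAt ℂ (fun w => F w * ((w - c) ^ 2 - r ^ 2) * G w) w := by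
      intro w hw
      refine DifferentiableAt.mul (by fun_prop)
        (differentiableAt_momentSeries hν ((hre w hw).trans_le (Complex.abs_re_le_norm w)))
    rw [← Complex.circleIntegral_eq_zero_of_differentiable_on_off_countable hr.le
      Set.countable_empty (fun w hw => (hd w hw).continuousAt.continuousWithinAt)
        fun w hw => hd w (Metric.ball_subset_closedBall hw.1)]
    refine circleIntegral.integral_congr hr.le fun w hw => ?_
    -- At the two real points of the circle the transform is uncontrolled, but the weight is zero.
    by_cases him : w.im = 0
    · have hz : (w - c) ^ 2 - (r : ℂ) ^ 2 = 0 := by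
        rw [mem_sphere_iff_norm] at hw
        have h1 : w = (w.re : ℂ) := Complex.ext rfl (by simpa using him)
        rw [h1, ← Complex.ofReal_sub, Complex.norm_real, Real.norm_eq_abs] at hw
        rw [h1, ← hw, ← Complex.ofReal_sub, ← Complex.ofReal_pow, ← Complex.ofReal_pow, sq_abs,
          sub_self]
      simp only [hz, mul_zero, zero_mul]
    · rw [cauchyTransform_eq_momentSeries hu hum hν him
        (hre w (Metric.sphere_subset_closedBall hw))]
  let f : ℝ → ℂ := (Set.Ioo (c - r) (c + r)).indicator
    fun x => ((x : ℂ) - c) ^ 2 * u x - (r : ℂ) ^ 2 * u x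
  have hfi : Integrable f M := by
    refine (hui.norm.const_mul (2 * r ^ 2)).mono' (AEStronglyMeasurable.indicator
      (((Continuous.aestronglyMeasurable (by fun_prop)).mul hum).sub (hum.const_mul _))
      measurableSet_Ioo) (Eventually.of_forall fun x => ?_)
    by_cases hx : x ∈ Set.Ioo (c - r) (c + r)
    · simp only [f, Set.indicator_of_mem hx]
      have h1 : |x - c| ≤ r := abs_le.2 ⟨by linarith [hx.1], by linarith [hx.2]⟩
      refine (norm_sub_le _ _).trans ?_
      rw [norm_mul, norm_mul, norm_pow, norm_pow, ← Complex.ofReal_sub, Complex.norm_real,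
        Complex.norm_real, Real.norm_eq_abs, Real.norm_eq_abs, abs_of_pos hr, ← add_mul, two_mul]
      gcongr
    · simp only [f, Set.indicator_of_notMem hx, norm_zero]
      positivity
  have h0 : ∀ᵐ x ∂M, f x = 0 := by
    refine ae_eq_zero_of_integral_polynomial hfi (a := c - r) (b := c + r)
      (fun x hx => Set.indicator_of_notMem (fun h => hx (Set.Ioo_subset_Icc_self h)) _) fun p => ?_
    have h1 := circleIntegral_cauchyTransform hui
      (F := fun w => (p.map (algebraMap ℝ ℂ)).eval w) (Polynomial.differentiable _) (c := c) hr
    rw [hcirc _ (Polynomial.differentiable _)] at h1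
    have h2 : (2 * Real.pi * Complex.I : ℂ) ≠ 0 := Complex.two_pi_I_ne_zero
    refine (mul_eq_zero.1 (h1.trans ?_).symm).resolve_left h2
    rw [← integral_const_mul]
    congr 1; ext x
    have h3 : (p.map (algebraMap ℝ ℂ)).eval (x : ℂ) = ((p.eval x : ℝ) : ℂ) := by
      rw [Polynomial.eval_map_algebraMap]
      exact Polynomial.aeval_algebraMap_apply_eq_algebraMap_eval x p
    by_cases hx : x ∈ Set.Ioo (c - r) (c + r)
    · simp only [f, Set.indicator_of_mem hx, h3]; ring
    · simp only [f, Set.indicator_of_notMem hx]; ring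
  filter_upwards [h0] with x hx hxI
  simp only [f, Set.indicator_of_mem hxI, ← sub_mul] at hx
  refine (mul_eq_zero.1 hx).resolve_left fun h => ?_
  have h4 : (x - c) ^ 2 = r ^ 2 := by
    have := sub_eq_zero.1 h
    exact_mod_cast this
  nlinarith [hxI.1, hxI.2]

theorem ae_eq_zero_of_one_lt_abs {M : Measure ℝ} [SFinite M] {u : ℝ → ℂ}
    (hu : ∀ t : ℝ, Integrable (fun x : ℝ => Real.exp (t * |x|) * ‖u x‖) M)
    (hum : AEStronglyMeasurable u M) {B : ℝ}
    (hν : ∀ n : ℕ, ‖∫ x : ℝ, (x : ℂ) ^ n * u x ∂M‖ ≤ B) :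
    ∀ᵐ x ∂M, 1 < |x| → u x = 0 := by
  have hall : ∀ᵐ x ∂M, ∀ q : ℚ × ℚ, 0 < (q.2 : ℝ) → 1 + (q.2 : ℝ) < |(q.1 : ℝ)| →
      x ∈ Set.Ioo ((q.1 : ℝ) - q.2) (q.1 + q.2) → u x = 0 := by
    rw [ae_all_iff]
    intro q
    by_cases h1 : 0 < (q.2 : ℝ)
    · by_cases h2 : 1 + (q.2 : ℝ) < |(q.1 : ℝ)|
      · filter_upwards [ae_eq_zero_on_Ioo hu hum hν h1 h2] with x hx _ _ using hx
      · exact Eventually.of_forall fun x _ h => absurd h h2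
    · exact Eventually.of_forall fun x h => absurd h h1
  filter_upwards [hall] with x hx h1
  -- With `|x - c| < r`, the half ensures `|c| > |x| - r > 1 + r`.
  obtain ⟨r, hr0, hr⟩ := exists_rat_btwn (show (0 : ℝ) < (|x| - 1) / 2 by linarith)
  obtain ⟨c, hc0, hc⟩ := exists_rat_btwn (show x - r < x + r by linarith)
  have h2 : |x - c| < r := abs_lt.2 ⟨by linarith, by linarith⟩
  have h3 := abs_sub_abs_le_abs_sub x c
  exact hx (c, r) hr0 (by simp only; linarith) ⟨by simp only; linarith, by simp only; linarith⟩

/-! ### The endpoints -/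

theorem tendsto_pow_of_abs_lt_one {x : ℝ} (hx : |x| < 1) :
    Tendsto (fun n : ℕ => (x : ℂ) ^ n) atTop (nhds 0) :=
  tendsto_pow_atTop_nhds_zero_of_norm_lt_one (by simpa using hx)

/-- A density on `[-1, 1]` whose moments tend to zero charges neither endpoint. -/
theorem ae_eq_zero_of_abs_eq_one {M : Measure ℝ} [IsFiniteMeasure M] {u : ℝ → ℂ}
    (hu : Integrable u M) (hsupp : ∀ᵐ x ∂M, 1 < |x| → u x = 0)
    (hν : Tendsto (fun n : ℕ => ∫ x : ℝ, (x : ℂ) ^ n * u x ∂M) atTop (nhds 0)) :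
    ∀ᵐ x ∂M, |x| = 1 → u x = 0 := by
  -- The a.e. limit of `x ^ (2 * n + j) * u x`, dominated by `‖u x‖`; the parities `j = 0, 1` give
  -- the sum and difference of the two atoms.
  let v : ℕ → ℝ → ℂ := fun j => (({1} : Set ℝ) ∪ {-1}).indicator fun x => (x : ℂ) ^ j * u x
  have hlim (j : ℕ) : ∫ x, v j x ∂M = 0 := by
    have h1 : Tendsto (fun n : ℕ => ∫ x : ℝ, (x : ℂ) ^ (2 * n + j) * u x ∂M) atTop (nhds 0) :=
      hν.comp (tendsto_atTop_mono (fun n => (by omega : n ≤ 2 * n + j)) tendsto_id)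
    refine tendsto_nhds_unique (tendsto_integral_of_dominated_convergence
      (F := fun (n : ℕ) (x : ℝ) => (x : ℂ) ^ (2 * n + j) * u x) (fun x => ‖u x‖)
      (fun n => (Continuous.aestronglyMeasurable (by fun_prop)).mul hu.aestronglyMeasurable)
      hu.norm (fun n => ?_) ?_) h1
    · filter_upwards [hsupp] with x hx
      by_cases h : 1 < |x|
      · simp [hx h]
      · rw [norm_mul, norm_pow, Complex.norm_real, Real.norm_eq_abs]
        exact mul_le_of_le_one_left (norm_nonneg _) (pow_le_one₀ (abs_nonneg _) (not_lt.1 h))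
    · filter_upwards [hsupp] with x hx
      rcases lt_trichotomy |x| 1 with h | h | h
      · have hne : x ∉ ({1} : Set ℝ) ∪ {-1} := by
          rintro (rfl | rfl) <;> simp at h
        simp only [v, Set.indicator_of_notMem hne]
        have := (tendsto_pow_of_abs_lt_one h).comp
          (tendsto_atTop_mono (fun n => (by omega : n ≤ 2 * n + j)) tendsto_id)
        simpa using this.mul_const (u x)
      · have hmem : x ∈ ({1} : Set ℝ) ∪ {-1} := eq_or_eq_neg_of_abs_eq h
        simp only [v, Set.indicator_of_mem hmem]
        have hx2 : (x : ℂ) ^ 2 = 1 := by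
          rw [← Complex.ofReal_pow, ← sq_abs, h]; simp
        simp only [pow_add, pow_mul, hx2, one_pow, one_mul]
        exact tendsto_const_nhds
      · simp [hx h, v, Set.indicator_apply]
  have hv (j : ℕ) : M.real {1} * u 1 + (-1) ^ j * (M.real {-1} * u (-1)) = 0 := by
    have hms : MeasurableSet (({1} : Set ℝ) ∪ {-1}) := by measurability
    rw [← hlim j, integral_indicator hms, setIntegral_union (by norm_num) (by measurability),
      integral_singleton, integral_singleton]
    · simp; ring
    · exact integrableOn_singleton
    · exact integrableOn_singleton
  have e0 := hv 0
  have e1 := hv 1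
  have h1 : (M.real {1} : ℂ) * u 1 = 0 := by linear_combination (e0 + e1) / 2
  have h2 : (M.real {-1} : ℂ) * u (-1) = 0 := by linear_combination (e0 - e1) / 2
  have key (a : ℝ) (ha : (M.real {a} : ℂ) * u a = 0) : ∀ᵐ x ∂M, x = a → u x = 0 := by
    rcases mul_eq_zero.1 ha with h | h
    · have h0 : M {a} = 0 := by
        rw [Complex.ofReal_eq_zero, measureReal_eq_zero_iff] at h
        exact h
      have : ∀ᵐ x ∂M, x ∉ ({a} : Set ℝ) := measure_eq_zero_iff_ae_notMem.1 h0
      filter_upwards [this] with x hx hxa using absurd hxa hx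
    · exact Eventually.of_forall fun x hx => hx ▸ h
  filter_upwards [key 1 h1, key (-1) h2] with x hx1 hx2 h
  exact (eq_or_eq_neg_of_abs_eq h).elim hx1 hx2

end HamburgerMoment

end

/-! ### Conclusion -/

theorem mainTheorem3 (M : Measure ℝ) (hM : HamburgerMoment.PolynomialsInL2 M)
    (hq : (fun n : ℕ => HamburgerMoment.moment M (2 * n) ^ (1 / (2 * (n : ℝ))))
      =o[atTop] (fun n : ℕ => (n : ℝ))) :
    HamburgerMoment.Determinate (HamburgerMoment.moment M) ∧
      ((HamburgerMoment.operatorA M hM).IsClosable →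
        M (Set.Ioo (-1 : ℝ) 1)ᶜ = 0 ∧
          M.support ⊆ Set.Icc (-1 : ℝ) 1 ∧ M {1} = 0 ∧ M {-1} = 0) := by
  open HamburgerMoment in
  have := hM.isFiniteMeasure
  refine ⟨⟨M, ⟨hM, fun _ => rfl⟩, fun N hN => eq_of_moment_eq hM hN.1 hq hN.2⟩, fun hcl => ?_⟩
  have hS : MeasurableSet (Set.Ioo (-1 : ℝ) 1)ᶜ := measurableSet_Ioo.compl
  have hmain : M (Set.Ioo (-1 : ℝ) 1)ᶜ = 0 := by
    let v : Lp ℂ 2 M := indicatorConstLp 2 hS (measure_ne_top M _) 1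
    have hv0 : v = 0 := by
      refine eq_zero_of_isClosable hcl fun k ⟨h, hk⟩ => ?_
      -- The conjugate appears because the inner product is conjugate-linear in its first argument.
      let u : ℝ → ℂ := fun x => (starRingEnd ℂ) (k x)
      have hmom (n : ℕ) : ∫ x : ℝ, (x : ℂ) ^ n * u x ∂M = (starRingEnd ℂ) (h n) :=
        integral_pow_mul_conj_eq hM hk n
      have hu2 : MemLp u 2 M := (Lp.memLp k).star
      have hui : Integrable u M := hu2.integrable (by norm_num)
      have hsq : Tendsto (fun n => ‖h n‖ ^ 2) atTop (nhds 0) := by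
        have := (lp.memℓp h).summable (by norm_num)
        simpa using this.tendsto_atTop_zero
      have hlim : Tendsto (fun n => ∫ x : ℝ, (x : ℂ) ^ n * u x ∂M) atTop (nhds 0) := by
        rw [tendsto_zero_iff_norm_tendsto_zero]
        simp only [hmom, RCLike.norm_conj]
        simpa using hsq.sqrt
      have hgt := ae_eq_zero_of_one_lt_abs ((hM.hasExpMoments hq).integrable_exp_mul hu2)
        hui.aestronglyMeasurable (B := ‖h‖) fun n => by
          rw [hmom, RCLike.norm_conj]
          exact lp.norm_apply_le_norm (by norm_num) h n
      have heq := ae_eq_zero_of_abs_eq_one hui hgt hlim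
      rw [L2.inner_def]
      refine integral_eq_zero_of_ae ?_
      filter_upwards [hgt, heq, indicatorConstLp_coeFn (p := 2) (hs := hS)
        (hμs := measure_ne_top M _) (c := (1 : ℂ))] with x h1 h2 h3
      by_cases hx : x ∈ (Set.Ioo (-1 : ℝ) 1)ᶜ
      · have hx1 : 1 ≤ |x| := by
          by_contra hlt
          exact hx (abs_lt.1 (not_le.1 hlt))
        have hux : u x = 0 := hx1.lt_or_eq.elim h1 fun h => h2 h.symm
        have hkx : k x = 0 := by simpa [u] using hux
        simp [hkx]
      · have : v x = 0 := by rw [h3, Set.indicator_of_notMem hx]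
        simp [this]
    have h0 : ∀ᵐ x ∂M, x ∉ (Set.Ioo (-1 : ℝ) 1)ᶜ := by
      filter_upwards [indicatorConstLp_coeFn (p := 2) (hs := hS)
        (hμs := measure_ne_top M _) (c := (1 : ℂ)), Lp.coeFn_zero ℂ 2 M] with x h1 h2 hx
      have h3 : v x = 0 := by rw [hv0]; exact h2
      rw [h1, Set.indicator_of_mem hx] at h3
      exact one_ne_zero h3
    exact measure_eq_zero_iff_ae_notMem.2 h0
  refine ⟨hmain, Measure.support_subset_of_isClosed isClosed_Icc ?_,
    measure_mono_null ?_ hmain, measure_mono_null ?_ hmain⟩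
  · exact mem_ae_iff.2 (measure_mono_null (Set.compl_subset_compl.2 Set.Ioo_subset_Icc_self) hmain)
  · simp
  · simp
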